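/- Let $\mathbf A\in\mathbb R^{n\times p}$, $\boldsymbol y\in\mathbb R^n$, let $\|\cdot\|$ be the Euclidean norm, and let $$F(\boldsymbol x)=\|\boldsymbol x\|_1+\tfrac12\|\mathbf A\boldsymbol x-\boldsymbol y\|^2,\qquad \boldsymbol x\in\mathbb R^p .$$ Fix $\kappa>0$. For $\beta>0$ let $X_\beta$ be a random vector of $\mathbb R^p$ with probability density proportional to $\exp(-\kappa\beta F(\boldsymbol x))$. Let $\boldsymbol x(\boldsymbol y)$ be a minimizer of $F$ (a Lasso estimator) and put $$\xi=\mathbf A^*(\boldsymbol y-\mathbf A\boldsymbol x(\boldsymbol y)),\quad \partial I=\{i:|\xi_i|=1\},\quad S=\{i:x_i(\boldsymbol y)\ne0\},\quad I_0=\{i:x_i(\boldsymbol y)=0\},\quad \partial I_0=\{i\in I_0:|\xi_i|=1\}.$$ For $J\subset\{1,\dots,p\}$ let $\mathbf A_J$ be the submatrix of the columns of $\mathbf A$ indexed by $J$. Assume that $\mathbf A_{\partial I}^*\mathbf A_{\partial I}$ is invertible. Then, as $\beta\to+\infty$, the two blocks $$U_\beta=\big(\beta X_\beta(i):\ i\in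 I_0\setminus\partial I_0\big),\qquad V_\beta=\big(\sqrt\beta\,(X_\beta(i)-x_i(\boldsymbol y)):\ i\in S\cup\partial I_0\big)$$ are asymptotically independent: the total variation distance between the law of $(U_\beta,V_\beta)$ and the product of the laws of $U_\beta$ and $V_\beta$ tends to $0$. Moreover the laws of $U_\beta$ and $V_\beta$ converge in total variation to the probability measures whose densities are proportional, respectively, to $$u\mapsto\prod_{i\in I_0\setminus\partial I_0}\exp\big(-\kappa|u_i|(1-\operatorname{sgn}(u_i)\xi_i)\big),$$ $$v\mapsto\exp\Big(-\frac{\kappa}{2}\|\mathbf A_{S\cup\partial I_0}v\|^2\Big)\,\mathbf 1\{\xi_iv_i\ge0\ \text{for all } i\in\partial I_0\},$$ and these two functions have positive finite integrals. (If $\partial I_0=\emptyset$ the second limit is an ordinary centred Gaussian.) -/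

import Mathlib

open MeasureTheory ProbabilityTheory Filter Topology Matrix

noncomputable section

namespace BayesLasso

variable {n p : ℕ}

/-- The Euclidean norm on coordinate vectors. -/
def euclNorm {ι : Type*} [Fintype ι] (v : ι → ℝ) : ℝ := ‖WithLp.toLp 2 v‖

/-- The Lasso objective `F(x) = ‖x‖₁ + ‖A x - y‖² / 2` (with the Euclidean norm). -/
def objective (A : Matrix (Fin n) (Fin p) ℝ) (y : Fin n → ℝ) (x : Fin p → ℝ) : ℝ :=
  (∑ i, |x i|) + euclNorm (A *ᵥ x - y) ^ 2 / 2

/-- `x` is a Lasso estimator: a global minimizer of the objective. -/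
def IsLasso (A : Matrix (Fin n) (Fin p) ℝ) (y : Fin n → ℝ) (x : Fin p → ℝ) : Prop :=
  ∀ z : Fin p → ℝ, objective A y x ≤ objective A y z

/-- The probability measure on `ℝ^ι` whose Lebesgue density is proportional to `h ≥ 0`
(meaningful when the integral of `h` is positive and finite; it is the zero measure otherwise). -/
def measureOfPropDensity {ι : Type*} [Fintype ι] (h : (ι → ℝ) → ℝ) : Measure (ι → ℝ) :=
  (∫⁻ x, ENNReal.ofReal (h x))⁻¹ • volume.withDensity (fun x => ENNReal.ofReal (h x))

/-- The law on `ℝ^p` with density `exp(-κ β F(x)) / Z`. -/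
def posterior (A : Matrix (Fin n) (Fin p) ℝ) (y : Fin n → ℝ) (κ β : ℝ) : Measure (Fin p → ℝ) :=
  measureOfPropDensity fun x => Real.exp (-(κ * β * objective A y x))

/-- `ξ = Aᵀ (y - A x)`. -/
def dual (A : Matrix (Fin n) (Fin p) ℝ) (y : Fin n → ℝ) (x : Fin p → ℝ) : Fin p → ℝ :=
  Aᵀ *ᵥ (y - A *ᵥ x)

open Classical in
/-- `∂I = {i : |ξ_i| = 1}`. -/
def bdryI (A : Matrix (Fin n) (Fin p) ℝ) (y : Fin n → ℝ) (x : Fin p → ℝ) : Finset (Fin p) :=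
  Finset.univ.filter fun i => |dual A y x i| = 1

open Classical in
/-- The support `S = {i : x_i ≠ 0}`. -/
def supp (x : Fin p → ℝ) : Finset (Fin p) := Finset.univ.filter fun i => x i ≠ 0

open Classical in
/-- `I₀ = {i : x_i = 0}`. -/
def I0 (x : Fin p → ℝ) : Finset (Fin p) := Finset.univ.filter fun i => x i = 0

open Classical in
/-- `∂I₀ = {i : x_i = 0 and |ξ_i| = 1}`. -/
def bdryI0 (A : Matrix (Fin n) (Fin p) ℝ) (y : Fin n → ℝ) (x : Fin p → ℝ) : Finset (Fin p) :=
  Finset.univ.filter fun i => x i = 0 ∧ |dual A y x i| = 1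

/-- The submatrix `A_J` made of the columns of `A` indexed by `J`. -/
def cols (A : Matrix (Fin n) (Fin p) ℝ) (J : Finset (Fin p)) : Matrix (Fin n) J ℝ :=
  A.submatrix id (fun j : J => (j : Fin p))

/-- The unnormalized limit density of the block `(β X_β(i))`, `i ∈ I₀ ∖ ∂I₀`:
`∏ exp(-κ |u_i| (1 - sgn(u_i) ξ_i))`. -/
def laplaceDensity (A : Matrix (Fin n) (Fin p) ℝ) (y : Fin n → ℝ) (xs : Fin p → ℝ) (κ : ℝ)
    (u : ↥(I0 xs \ bdryI0 A y xs) → ℝ) : ℝ :=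
  ∏ i, Real.exp (-(κ * (|u i| * (1 - Real.sign (u i) * dual A y xs i))))

/-- The unnormalized limit density of the block `(√β (X_β(i) - x_i(y)))`, `i ∈ S ∪ ∂I₀`:
`exp(-κ ‖A_{S ∪ ∂I₀} v‖² / 2)` on the set of `v` with `ξ_i v_i ≥ 0` for all `i ∈ ∂I₀`,
and `0` elsewhere. -/
def gaussDensity (A : Matrix (Fin n) (Fin p) ℝ) (y : Fin n → ℝ) (xs : Fin p → ℝ) (κ : ℝ) :
    (↥(supp xs ∪ bdryI0 A y xs) → ℝ) → ℝ :=
  Set.indicator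
    {v | ∀ i : ↥(supp xs ∪ bdryI0 A y xs), (i : Fin p) ∈ bdryI0 A y xs →
      0 ≤ dual A y xs i * v i}
    (fun v => Real.exp (-(κ * (euclNorm (cols A (supp xs ∪ bdryI0 A y xs) *ᵥ v) ^ 2 / 2))))

/-- The total variation distance between the (finite) measures `μ b` and `ν b` tends to `0`
as `b → +∞`: the supremum over measurable sets `B` of `|μ b B - ν b B|` tends to `0`. -/
def TVClose {E : Type*} [MeasurableSpace E] (μ ν : ℝ → Measure E) : Prop :=
  ∀ ε : ℝ, 0 < ε → ∀ᶠ b in atTop, ∀ B : Set E, MeasurableSet B →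
    |(μ b).real B - (ν b).real B| ≤ ε

/-- Asymptotic independence of `U b` and `V b` as `b → +∞`: the joint law and the product of the
two marginal laws become close in total variation. -/
def AsympIndep {Ω : ℝ → Type*} [∀ b, MeasurableSpace (Ω b)] (P : ∀ b, Measure (Ω b))
    {E E' : Type*} [MeasurableSpace E] [MeasurableSpace E']
    (U : ∀ b, Ω b → E) (V : ∀ b, Ω b → E') : Prop :=
  TVClose (fun b => (P b).map fun ω => (U b ω, V b ω))
    (fun b => ((P b).map (U b)).prod ((P b).map (V b)))

/-- The law of `U b` converges in total variation, as `b → +∞`, to the probability measure whose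
density is proportional to `h`. -/
def HasAsympDensity {Ω : ℝ → Type*} [∀ b, MeasurableSpace (Ω b)] (P : ∀ b, Measure (Ω b))
    {ι : Type*} [Fintype ι] (U : ∀ b, Ω b → ι → ℝ) (h : (ι → ℝ) → ℝ) : Prop :=
  IsProbabilityMeasure (measureOfPropDensity h) ∧
    TVClose (fun b => (P b).map (U b)) (fun _ => measureOfPropDensity h)

end BayesLasso

end

/-! Put `J = S ∪ ∂I₀` and measure the fluctuation of `X_β` around the Lasso estimator in units of
`β^(-1/2)` on `J` and of `β⁻¹` off `J`. At a displacement `h` from the estimator the objective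
increases by the sum of the subgradient gaps `|x_i + h_i| - |x_i| - ξ_i h_i`, which are nonnegative
by optimality, plus `‖A h‖² / 2`. After rescaling, `β` times this increase separates in the limit:
off `J` the gaps are homogeneous and `A h` is negligible; on `S` the gaps vanish eventually; on
`∂I₀` they vanish or blow up according to the sign of `ξ_i h_i`; and the quadratic term keeps only
the columns of `J`. Since `|ξ_i| < 1` off `J` and `A_J` is injective, the rescaled increase also
dominates a multiple of the `ℓ¹` norm, up to a constant, uniformly in `β ≥ 1`. By dominated
convergence the rescaled laws therefore converge in total variation, and the limit is the product of
the two claimed laws. Convergence of the joint law to a product gives both the marginal limits and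
the asymptotic independence. -/

noncomputable section

namespace BayesLasso

section TotalVariation

variable {E E' : Type*} [MeasurableSpace E] [MeasurableSpace E'] {μ μ' ρ : ℝ → Measure E}
  {ν ν' : ℝ → Measure E'}

theorem TVClose.congr (h : TVClose μ ρ) (hμ : μ' =ᶠ[atTop] μ) : TVClose μ' ρ := by
  intro ε hε
  filter_upwards [h ε hε, hμ] with b hb hμb B hB
  rw [hμb]
  exact hb B hB

theorem TVClose.symm (h : TVClose μ ρ) : TVClose ρ μ := by
  intro ε hε
  filter_upwards [h ε hε] with b hb B hB
  rw [abs_sub_comm]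
  exact hb B hB

theorem TVClose.trans (h : TVClose μ μ') (h' : TVClose μ' ρ) : TVClose μ ρ := by
  intro ε hε
  filter_upwards [h (ε / 2) (half_pos hε), h' (ε / 2) (half_pos hε)] with b hb hb' B hB
  calc |(μ b).real B - (ρ b).real B| ≤ _ := abs_sub_le _ ((μ' b).real B) _
    _ ≤ ε / 2 + ε / 2 := add_le_add (hb B hB) (hb' B hB)
    _ = ε := add_halves ε

theorem TVClose.map (h : TVClose μ ρ) {f : E → E'} (hf : Measurable f) :
    TVClose (fun b => (μ b).map f) (fun b => (ρ b).map f) := by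
  intro ε hε
  filter_upwards [h ε hε] with b hb B hB
  rw [map_measureReal_apply hf hB, map_measureReal_apply hf hB]
  exact hb _ (hf hB)

theorem abs_measureReal_prod_sub_le {μ : Measure E} {ν ν' : Measure E'}
    [IsZeroOrProbabilityMeasure μ] [IsFiniteMeasure ν] [IsFiniteMeasure ν'] {ε : ℝ}
    (h : ∀ B, MeasurableSet B → |ν.real B - ν'.real B| ≤ ε) {B : Set (E × E')}
    (hB : MeasurableSet B) : |(μ.prod ν).real B - (μ.prod ν').real B| ≤ ε := by
  have hε : 0 ≤ ε := (abs_nonneg _).trans (h ∅ MeasurableSet.empty)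
  have integrable_fiber (τ : Measure E') [IsFiniteMeasure τ] :
      Integrable (fun x => τ.real (Prod.mk x ⁻¹' B)) μ :=
    Integrable.of_bound (measurable_measure_prodMk_left hB).ennreal_toReal.aestronglyMeasurable
      (τ.real Set.univ) (Eventually.of_forall fun x => by
        rw [Real.norm_of_nonneg measureReal_nonneg]
        exact measureReal_mono (Set.subset_univ _))
  have prod_eq_integral (τ : Measure E') [IsFiniteMeasure τ] :
      (μ.prod τ).real B = ∫ x, τ.real (Prod.mk x ⁻¹' B) ∂μ := by
    rw [measureReal_def, Measure.prod_apply hB]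
    exact (integral_toReal (measurable_measure_prodMk_left hB).aemeasurable
      (Eventually.of_forall fun x => measure_lt_top _ _)).symm
  rw [prod_eq_integral, prod_eq_integral,
    ← integral_sub (integrable_fiber ν) (integrable_fiber ν'), ← Real.norm_eq_abs]
  calc ‖∫ x, (ν.real (Prod.mk x ⁻¹' B) - ν'.real (Prod.mk x ⁻¹' B)) ∂μ‖
      ≤ ε * μ.real Set.univ := norm_integral_le_of_norm_le_const
        (Eventually.of_forall fun x => h _ (measurable_prodMk_left hB))
    _ ≤ ε := mul_le_of_le_one_right hε measureReal_le_one

theorem TVClose.prod [∀ b, IsZeroOrProbabilityMeasure (μ b)]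
    [∀ b, IsZeroOrProbabilityMeasure (μ' b)] [∀ b, IsZeroOrProbabilityMeasure (ν b)]
    [∀ b, IsZeroOrProbabilityMeasure (ν' b)] (h : TVClose μ μ') (h' : TVClose ν ν') :
    TVClose (fun b => (μ b).prod (ν b)) (fun b => (μ' b).prod (ν' b)) := by
  have replace_right : TVClose (fun b => (μ b).prod (ν b)) (fun b => (μ b).prod (ν' b)) := by
    intro ε hε
    filter_upwards [h' ε hε] with b hb B hB
    exact abs_measureReal_prod_sub_le hb hB
  have replace_left : TVClose (fun b => (ν' b).prod (μ b)) (fun b => (ν' b).prod (μ' b)) := by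
    intro ε hε
    filter_upwards [h ε hε] with b hb B hB
    exact abs_measureReal_prod_sub_le hb hB
  have := replace_left.map measurable_swap
  simp only [Measure.prod_swap] at this
  exact replace_right.trans this

instance isZeroOrProbabilityMeasure_map (μ : Measure E) [IsZeroOrProbabilityMeasure μ]
    (f : E → E') : IsZeroOrProbabilityMeasure (μ.map f) := by
  by_cases hf : AEMeasurable f μ
  · obtain rfl | _ := eq_zero_or_isProbabilityMeasure μ
    · simp only [Measure.map_zero]
      infer_instance
    · have := Measure.isProbabilityMeasure_map hf
      infer_instance
  · rw [Measure.map_of_not_aemeasurable hf]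
    infer_instance

variable {Ω : ℝ → Type*} [∀ b, MeasurableSpace (Ω b)] {P : ∀ b, Measure (Ω b)}

/- `Measure.map` sends a function that is not a.e.-measurable to `0`, which is at distance `1` from
every probability measure. -/
theorem TVClose.eventually_aemeasurable {W : ∀ b, Ω b → E} {π : Measure E}
    [IsProbabilityMeasure π] (h : TVClose (fun b => (P b).map (W b)) (fun _ => π)) :
    ∀ᶠ b in atTop, AEMeasurable (W b) (P b) := by
  filter_upwards [h (1 / 2) one_half_pos] with b hb
  by_contra hW
  have := hb Set.univ MeasurableSet.univ
  rw [Measure.map_of_not_aemeasurable hW] at this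
  norm_num at this

theorem TVClose.map_comp {W : ∀ b, Ω b → E} {π : Measure E} [IsProbabilityMeasure π]
    (h : TVClose (fun b => (P b).map (W b)) (fun _ => π)) {f : E → E'} (hf : Measurable f) :
    TVClose (fun b => (P b).map fun ω => f (W b ω)) (fun _ => π.map f) := by
  refine (h.map hf).congr ?_
  filter_upwards [h.eventually_aemeasurable] with b hW
  exact (AEMeasurable.map_map_of_aemeasurable hf.aemeasurable hW).symm

theorem TVClose.of_hasLaw {X : ∀ b, Ω b → E} (hX : ∀ᶠ b in atTop, HasLaw (X b) (μ b) (P b))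
    {f : ℝ → E → E'} (hf : ∀ b, Measurable (f b)) (h : TVClose (fun b => (μ b).map (f b)) ν) :
    TVClose (fun b => (P b).map fun ω => f b (X b ω)) ν := by
  refine h.congr ?_
  filter_upwards [hX] with b hb
  rw [← hb.map_eq, AEMeasurable.map_map_of_aemeasurable (hf b).aemeasurable hb.aemeasurable]
  rfl

theorem asympIndep_of_tvClose_prod [∀ b, IsZeroOrProbabilityMeasure (P b)] {U : ∀ b, Ω b → E}
    {V : ∀ b, Ω b → E'} {π : Measure E} {σ : Measure E'} [IsProbabilityMeasure π]
    [IsProbabilityMeasure σ]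
    (h : TVClose (fun b => (P b).map fun ω => (U b ω, V b ω)) (fun _ => π.prod σ)) :
    AsympIndep P U V ∧ TVClose (fun b => (P b).map (U b)) (fun _ => π) ∧
      TVClose (fun b => (P b).map (V b)) (fun _ => σ) := by
  have hU : TVClose (fun b => (P b).map (U b)) (fun _ => π) := by
    simpa only [Measure.map_fst_prod, measure_univ, one_smul] using h.map_comp measurable_fst
  have hV : TVClose (fun b => (P b).map (V b)) (fun _ => σ) := by
    simpa only [Measure.map_snd_prod, measure_univ, one_smul] using h.map_comp measurable_snd
  exact ⟨h.trans (hU.prod hV).symm, hU, hV⟩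

end TotalVariation

section Normalization

variable {α γ : Type*} [MeasurableSpace α] [MeasurableSpace γ]

/-- The probability measure proportional to `μ`. It is the zero measure when the total mass of `μ`
is `0` or `∞`. -/
def normalized (μ : Measure α) : Measure α := (μ Set.univ)⁻¹ • μ

instance (μ : Measure α) : IsZeroOrProbabilityMeasure (normalized μ) :=
  inferInstanceAs (IsZeroOrProbabilityMeasure ((μ Set.univ)⁻¹ • μ))

instance (μ : Measure α) [IsFiniteMeasure μ] [NeZero μ] : IsProbabilityMeasure (normalized μ) :=
  inferInstanceAs (IsProbabilityMeasure ((μ Set.univ)⁻¹ • μ))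

theorem normalized_smul (μ : Measure α) {c : ENNReal} (h0 : c ≠ 0) (ht : c ≠ ⊤) :
    normalized (c • μ) = normalized μ := by
  rw [normalized, normalized, Measure.smul_apply, smul_smul, smul_eq_mul,
    ENNReal.mul_inv (Or.inl h0) (Or.inl ht), mul_right_comm, ENNReal.inv_mul_cancel h0 ht, one_mul]

theorem map_normalized (μ : Measure α) {f : α → γ} (hf : Measurable f) :
    (normalized μ).map f = normalized (μ.map f) := by
  rw [normalized, normalized, Measure.map_smul, Measure.map_apply hf MeasurableSet.univ,
    Set.preimage_univ]

theorem normalized_prod (μ : Measure α) (ν : Measure γ) [IsFiniteMeasure μ] [IsFiniteMeasure ν] :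
    normalized (μ.prod ν) = (normalized μ).prod (normalized ν) := by
  simp only [normalized]
  rw [Measure.prod_smul_left, Measure.prod_smul_right, smul_smul, ← Set.univ_prod_univ,
    Measure.prod_prod, ENNReal.mul_inv (Or.inr (measure_ne_top ν _)) (Or.inl (measure_ne_top μ _))]

instance neZero_prod (μ : Measure α) (ν : Measure γ) [SFinite ν] [NeZero μ] [NeZero ν] :
    NeZero (μ.prod ν) := by
  refine ⟨fun h => ?_⟩
  rw [← Measure.measure_univ_eq_zero, ← Set.univ_prod_univ, Measure.prod_prod] at h
  exact mul_ne_zero (NeZero.ne _) (NeZero.ne _) h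

theorem isFiniteMeasure_and_of_prod {μ : Measure α} {ν : Measure γ} [SFinite ν] [NeZero μ]
    [NeZero ν] (h : IsFiniteMeasure (μ.prod ν)) : IsFiniteMeasure μ ∧ IsFiniteMeasure ν := by
  have hlt : μ Set.univ * ν Set.univ < ⊤ := by
    rw [← Measure.prod_prod, Set.univ_prod_univ]
    exact measure_lt_top _ _
  exact ⟨⟨ENNReal.lt_top_of_mul_ne_top_left hlt.ne (NeZero.ne _)⟩,
    ⟨ENNReal.lt_top_of_mul_ne_top_right hlt.ne (NeZero.ne _)⟩⟩

theorem measureReal_normalized (μ : Measure α) (B : Set α) :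
    (normalized μ).real B = μ.real B / μ.real Set.univ := by
  rw [normalized, measureReal_ennreal_smul_apply, ENNReal.toReal_inv, ← measureReal_def,
    inv_mul_eq_div]

theorem TVClose.normalized {μ : ℝ → Measure α} {ν : Measure α} [IsFiniteMeasure ν] [NeZero ν]
    (h : TVClose μ (fun _ => ν)) :
    TVClose (fun b => normalized (μ b)) (fun _ => normalized ν) := by
  intro ε hε
  set H := ν.real Set.univ
  have hH : 0 < H := measureReal_univ_pos
  filter_upwards [h (ε * H / 2) (by positivity), h (H / 2) (half_pos hH)] with b hb hb' B hB
  set F := (μ b).real Set.univ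
  have hF : 0 < F := by linarith [(abs_le.1 (hb' Set.univ MeasurableSet.univ)).1]
  have : IsFiniteMeasure (μ b) :=
    ⟨lt_top_iff_ne_top.2 fun hμ => hF.ne' (by simp [F, measureReal_def, hμ])⟩
  have hle : (μ b).real B / F ≤ 1 := (div_le_one hF).2 (measureReal_mono (Set.subset_univ B))
  rw [measureReal_normalized, measureReal_normalized]
  calc |(μ b).real B / F - ν.real B / H|
      = |(μ b).real B / F * (H - F) + ((μ b).real B - ν.real B)| / H := by
        rw [← abs_of_pos hH, ← abs_div, abs_of_pos hH]
        congr 1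
        field_simp
        ring
    _ ≤ (1 * (ε * H / 2) + ε * H / 2) / H := by
        gcongr
        refine (abs_add_le _ _).trans (add_le_add ?_ (hb B hB))
        rw [abs_mul, abs_of_nonneg (by positivity), abs_sub_comm]
        gcongr
        exact hb Set.univ MeasurableSet.univ
    _ = ε := by field_simp; ring

theorem measureReal_withDensity_ofReal {μ : Measure α} {f : α → ℝ}
    (hf : AEStronglyMeasurable f μ) (hf0 : 0 ≤ᵐ[μ] f) {B : Set α} (hB : MeasurableSet B) :
    (μ.withDensity fun x => ENNReal.ofReal (f x)).real B = ∫ x in B, f x ∂μ := by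
  rw [measureReal_def, withDensity_apply _ hB,
    integral_eq_lintegral_of_nonneg_ae (ae_restrict_of_ae hf0) hf.restrict]

theorem tvClose_withDensity_of_dominated {μ : Measure α} {f : ℝ → α → ℝ} {g G : α → ℝ}
    (hf : ∀ b, Measurable (f b)) (hf0 : ∀ b, 0 ≤ f b) (hG : Integrable G μ)
    (hle : ∀ᶠ b in atTop, f b ≤ G) (hlim : ∀ x, Tendsto (fun b => f b x) atTop (𝓝 (g x))) :
    TVClose (fun b => μ.withDensity fun x => ENNReal.ofReal (f b x))
      (fun _ => μ.withDensity fun x => ENNReal.ofReal (g x)) := by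
  have hg : Measurable g := measurable_of_tendsto_metrizable' atTop hf (tendsto_pi_nhds.2 hlim)
  have hg0 : 0 ≤ g := fun x => ge_of_tendsto' (hlim x) fun b => hf0 b x
  have hgG : g ≤ G := fun x => le_of_tendsto (hlim x) (hle.mono fun b hb => hb x)
  have integrable_of_le {φ : α → ℝ} (hφ : Measurable φ) (h0 : 0 ≤ φ) (h : φ ≤ G) :
      Integrable φ μ := hG.mono' hφ.aestronglyMeasurable
    (Eventually.of_forall fun x => (Real.norm_of_nonneg (h0 x)).trans_le (h x))
  have hL1 : Tendsto (fun b => ∫ x, |f b x - g x| ∂μ) atTop (𝓝 (∫ _, 0 ∂μ)) := by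
    refine tendsto_integral_filter_of_dominated_convergence G
      (Eventually.of_forall fun b => ((hf b).sub hg).abs.aestronglyMeasurable)
      (hle.mono fun b hb => Eventually.of_forall fun x => ?_) hG
      (Eventually.of_forall fun x => ?_)
    · rw [Real.norm_eq_abs, abs_abs]
      exact abs_sub_le_of_nonneg_of_le (hf0 b x) (hb x) (hg0 x) (hgG x)
    · simpa using ((hlim x).sub_const (g x)).abs
  rw [integral_zero] at hL1
  intro ε hε
  filter_upwards [hle, hL1.eventually_lt_const hε] with b hb hbε B hB
  have hfi := integrable_of_le (hf b) (hf0 b) hb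
  have hgi := integrable_of_le hg hg0 hgG
  rw [measureReal_withDensity_ofReal (hf b).aestronglyMeasurable (ae_of_all _ (hf0 b)) hB,
    measureReal_withDensity_ofReal hg.aestronglyMeasurable (ae_of_all _ hg0) hB,
    ← integral_sub hfi.integrableOn hgi.integrableOn]
  calc |∫ x in B, (f b x - g x) ∂μ| ≤ ∫ x in B, |f b x - g x| ∂μ := abs_integral_le_integral_abs
    _ ≤ ∫ x, |f b x - g x| ∂μ := setIntegral_le_integral (hfi.sub hgi).abs
        (Eventually.of_forall fun x => abs_nonneg _)
    _ ≤ ε := hbε.le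

end Normalization

section EuclideanNorm

variable {m ι ι' : Type*} [Fintype m] [Fintype ι] [Fintype ι']

theorem euclNorm_sq (v : m → ℝ) : euclNorm v ^ 2 = v ⬝ᵥ v := by
  rw [euclNorm, EuclideanSpace.real_norm_sq_eq, dotProduct]
  exact Finset.sum_congr rfl fun i _ => sq _

theorem euclNorm_nonneg (v : m → ℝ) : 0 ≤ euclNorm v := norm_nonneg _

theorem euclNorm_smul (c : ℝ) (v : m → ℝ) : euclNorm (c • v) = |c| * euclNorm v := by
  rw [euclNorm, WithLp.toLp_smul, norm_smul, Real.norm_eq_abs, euclNorm]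

theorem euclNorm_sub_le_euclNorm_add (v w : m → ℝ) :
    euclNorm w - euclNorm v ≤ euclNorm (v + w) := by
  rw [add_comm]
  exact norm_sub_le_norm_add (WithLp.toLp 2 w) (WithLp.toLp 2 v)

theorem continuous_euclNorm : Continuous (euclNorm : (m → ℝ) → ℝ) :=
  continuous_norm.comp (PiLp.continuous_toLp 2 _)

theorem norm_toLp_one (v : ι → ℝ) : ‖WithLp.toLp 1 v‖ = ∑ i, |v i| := PiLp.norm_eq_of_L1 _

theorem exists_euclNorm_mulVec_le (B : Matrix m ι ℝ) :
    ∃ M, 0 ≤ M ∧ ∀ v, euclNorm (B *ᵥ v) ≤ M * ∑ i, |v i| := by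
  classical
  refine ⟨‖(toLpLin 1 2 B).toContinuousLinearMap‖, norm_nonneg _, fun v => ?_⟩
  rw [← norm_toLp_one]
  exact (toLpLin 1 2 B).toContinuousLinearMap.le_opNorm _

theorem exists_le_euclNorm_mulVec [DecidableEq ι] {B : Matrix m ι ℝ} (hB : IsUnit (Bᵀ * B)) :
    ∃ δ, 0 < δ ∧ ∀ v, δ * ∑ i, |v i| ≤ euclNorm (B *ᵥ v) := by
  have hker : LinearMap.ker (toLpLin 1 2 B) = ⊥ := by
    refine LinearMap.ker_eq_bot'.2 fun v hv => ?_
    have hBv : B *ᵥ v.ofLp = 0 := congrArg WithLp.ofLp hv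
    have : v.ofLp = 0 := (mulVec_injective_iff_isUnit.2 hB) <| by
      rw [← mulVec_mulVec, hBv, mulVec_zero, mulVec_zero]
    exact congrArg (WithLp.toLp 1) this
  obtain ⟨L, hL, hanti⟩ := LinearMap.exists_antilipschitzWith _ hker
  refine ⟨(L : ℝ)⁻¹, by positivity, fun v => ?_⟩
  rw [inv_mul_le_iff₀ (by positivity), ← norm_toLp_one]
  simpa [euclNorm] using hanti.le_mul_dist (WithLp.toLp 1 v) 0

theorem exists_mul_sum_abs_le_add_euclNorm_sq [DecidableEq ι'] (B : Matrix m ι ℝ)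
    {D : Matrix m ι' ℝ} (hD : IsUnit (Dᵀ * D)) {c : ℝ} (hc : 0 < c) :
    ∃ c' C, 0 < c' ∧ ∀ τ ∈ Set.Icc (0 : ℝ) 1, ∀ u v,
      c' * (∑ i, |u i| + ∑ i, |v i|) - C ≤
        c * ∑ i, |u i| + euclNorm (τ • (B *ᵥ u) + D *ᵥ v) ^ 2 / 2 := by
  obtain ⟨M, hM, hBle⟩ := exists_euclNorm_mulVec_le B
  obtain ⟨δ, hδ, hDle⟩ := exists_le_euclNorm_mulVec hD
  set t := c / (2 * (M + 1)) with ht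
  have : 0 < t := by positivity
  have htM : t * M ≤ c / 2 := by
    rw [ht, div_mul_eq_mul_div, div_le_div_iff₀ (by positivity) two_pos]
    nlinarith
  refine ⟨min (c / 2) (t * δ), t ^ 2 / 2, by positivity, fun τ hτ u v => ?_⟩
  set a := ∑ i, |u i|
  set b := ∑ i, |v i|
  set N := euclNorm (τ • (B *ᵥ u) + D *ᵥ v)
  have ha : 0 ≤ a := Finset.sum_nonneg fun i _ => abs_nonneg _
  have : 0 ≤ b := Finset.sum_nonneg fun i _ => abs_nonneg _
  have hN : δ * b - M * a ≤ N := by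
    refine le_trans (sub_le_sub (hDle v) ?_) (euclNorm_sub_le_euclNorm_add _ _)
    rw [euclNorm_smul, abs_of_nonneg hτ.1]
    exact (mul_le_of_le_one_left (euclNorm_nonneg _) hτ.2).trans (hBle u)
  calc min (c / 2) (t * δ) * (a + b) - t ^ 2 / 2
      ≤ c / 2 * a + t * δ * b - t ^ 2 / 2 := by
        rw [mul_add]
        gcongr
        exacts [min_le_left _ _, min_le_right _ _]
    _ ≤ c * a + (t * (δ * b - M * a) - t ^ 2 / 2) := by
        linarith [mul_le_mul_of_nonneg_right htM ha]
    _ ≤ c * a + (t * N - t ^ 2 / 2) := by gcongr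
    _ ≤ c * a + N ^ 2 / 2 := by linarith [sq_nonneg (N - t)]

end EuclideanNorm

section Subgradient

/-- The gap `|x + h| - |x| - ξ h` in the subgradient inequality of the absolute value. -/
def subgradGap (x ξ h : ℝ) : ℝ := |x + h| - |x| - ξ * h

theorem subgradGap_zero_left (ξ h : ℝ) : subgradGap 0 ξ h = |h| - ξ * h := by
  rw [subgradGap, zero_add, abs_zero, sub_zero]

theorem subgradGap_zero_right (x ξ : ℝ) : subgradGap x ξ 0 = 0 := by
  rw [subgradGap, add_zero, sub_self, mul_zero, sub_zero]

theorem continuous_subgradGap (x ξ : ℝ) : Continuous (subgradGap x ξ) := by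
  unfold subgradGap
  fun_prop

theorem subgradGap_zero_mul {c : ℝ} (hc : 0 ≤ c) (ξ h : ℝ) :
    subgradGap 0 ξ (c * h) = c * subgradGap 0 ξ h := by
  rw [subgradGap_zero_left, subgradGap_zero_left, abs_mul, abs_of_nonneg hc]
  ring

theorem one_sub_abs_mul_abs_le_subgradGap (ξ h : ℝ) : (1 - |ξ|) * |h| ≤ subgradGap 0 ξ h := by
  rw [subgradGap_zero_left, sub_mul, one_mul, ← abs_mul]
  gcongr
  exact le_abs_self _

theorem subgradGap_mul_le (x ξ h : ℝ) {s : ℝ} (hs : s ∈ Set.Icc 0 1) :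
    subgradGap x ξ (s * h) ≤ s * subgradGap x ξ h := by
  have : |x + s * h| ≤ s * |x + h| + (1 - s) * |x| :=
    calc |x + s * h| = |s * (x + h) + (1 - s) * x| := by ring_nf
      _ ≤ |s * (x + h)| + |(1 - s) * x| := abs_add_le _ _
      _ = s * |x + h| + (1 - s) * |x| := by
        rw [abs_mul, abs_mul, abs_of_nonneg hs.1, abs_of_nonneg (sub_nonneg.2 hs.2)]
  simp only [subgradGap]
  linarith

theorem subgradGap_eq_zero {x ξ h : ℝ} (hξ : ξ * x = |x|) (hh : 0 < x * (x + h)) :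
    subgradGap x ξ h = 0 := by
  rcases pos_and_pos_or_neg_and_neg_of_mul_pos hh with ⟨hx, hxh⟩ | ⟨hx, hxh⟩
  · have : ξ = 1 := mul_right_cancel₀ hx.ne' (by rw [hξ, abs_of_pos hx, one_mul])
    rw [subgradGap, abs_of_pos hx, abs_of_pos hxh, this]
    ring
  · have : ξ = -1 := mul_right_cancel₀ hx.ne (by rw [hξ, abs_of_neg hx, neg_one_mul])
    rw [subgradGap, abs_of_neg hx, abs_of_neg hxh, this]
    ring

theorem subgradGap_zero_eq_zero_iff {ξ h : ℝ} (hξ : |ξ| = 1) :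
    subgradGap 0 ξ h = 0 ↔ 0 ≤ ξ * h := by
  rw [subgradGap_zero_left, sub_eq_zero, ← abs_eq_self, abs_mul, hξ, one_mul]

theorem subgradGap_zero_nonneg {ξ : ℝ} (hξ : |ξ| ≤ 1) (h : ℝ) : 0 ≤ subgradGap 0 ξ h :=
  (mul_nonneg (sub_nonneg.2 hξ) (abs_nonneg h)).trans (one_sub_abs_mul_abs_le_subgradGap ξ h)

theorem abs_le_one_and_mul_self_of_subgradGap_nonneg {x ξ : ℝ} (h : ∀ t, 0 ≤ subgradGap x ξ t) :
    |ξ| ≤ 1 ∧ ξ * x = |x| := by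
  have hle := h x
  have hge := h (-x)
  have hone := h (-x + 1)
  have hneg := h (-x - 1)
  simp only [subgradGap, ← two_mul, abs_mul, abs_two, add_neg_cancel, abs_zero,
    add_neg_cancel_left, abs_one, ← add_sub_assoc, zero_sub, abs_neg] at hle hge hone hneg
  exact ⟨abs_le.2 ⟨by linarith, by linarith⟩, by linarith⟩

end Subgradient

variable {n p : ℕ}

section Optimality

theorem objective_add (A : Matrix (Fin n) (Fin p) ℝ) (y : Fin n → ℝ) (x h : Fin p → ℝ) :
    objective A y (x + h) - objective A y x =
      ∑ i, subgradGap (x i) (dual A y x i) (h i) + euclNorm (A *ᵥ h) ^ 2 / 2 := by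
  have residual : A *ᵥ (x + h) - y = (A *ᵥ x - y) + A *ᵥ h := by
    rw [mulVec_add]
    abel
  have sum_dual_mul : ∑ i, dual A y x i * h i = -((A *ᵥ x - y) ⬝ᵥ (A *ᵥ h)) := by
    change dual A y x ⬝ᵥ h = _
    rw [dual, mulVec_transpose, ← dotProduct_mulVec, ← neg_dotProduct, neg_sub]
  simp only [subgradGap, Finset.sum_sub_distrib]
  rw [sum_dual_mul, objective, objective, residual, euclNorm_sq, euclNorm_sq, euclNorm_sq,
    add_dotProduct, dotProduct_add, dotProduct_add, dotProduct_comm (A *ᵥ h) (A *ᵥ x - y)]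
  simp only [Pi.add_apply]
  ring

theorem continuous_objective (A : Matrix (Fin n) (Fin p) ℝ) (y : Fin n → ℝ) :
    Continuous (objective A y) := by
  have : Continuous fun x : Fin p → ℝ => euclNorm (A *ᵥ x - y) :=
    continuous_euclNorm.comp (by fun_prop)
  unfold objective
  fun_prop

variable {A : Matrix (Fin n) (Fin p) ℝ} {y : Fin n → ℝ} {xs : Fin p → ℝ}

theorem nonneg_of_forall_add_mul_nonneg {a q : ℝ} (h : ∀ s ∈ Set.Ioc (0 : ℝ) 1, 0 ≤ a + s * q) :
    0 ≤ a := by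
  have hlim : Tendsto (fun s : ℝ => a + s * q) (𝓝[>] 0) (𝓝 (a + 0 * q)) :=
    ((continuous_const.add (continuous_id.mul continuous_const)).tendsto 0).mono_left
      nhdsWithin_le_nhds
  rw [zero_mul, add_zero] at hlim
  exact ge_of_tendsto hlim (mem_of_superset (Ioc_mem_nhdsGT one_pos) h)

theorem IsLasso.subgradGap_nonneg (hxs : IsLasso A y xs) (i : Fin p) (t : ℝ) :
    0 ≤ subgradGap (xs i) (dual A y xs i) t := by
  refine nonneg_of_forall_add_mul_nonneg (q := euclNorm (A *ᵥ Pi.single i t) ^ 2 / 2)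
    fun s hs => nonneg_of_mul_nonneg_right ?_ hs.1
  calc 0 ≤ objective A y (xs + s • Pi.single i t) - objective A y xs := sub_nonneg.2 (hxs _)
    _ = subgradGap (xs i) (dual A y xs i) (s * t) +
        s ^ 2 * euclNorm (A *ᵥ Pi.single i t) ^ 2 / 2 := by
      rw [objective_add, mulVec_smul, euclNorm_smul, mul_pow, sq_abs,
        Finset.sum_eq_single i (fun j _ hj => by simp [hj, subgradGap_zero_right]) (by simp)]
      simp only [Pi.smul_apply, Pi.single_eq_same, smul_eq_mul]
    _ ≤ s * subgradGap (xs i) (dual A y xs i) t +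
        s ^ 2 * euclNorm (A *ᵥ Pi.single i t) ^ 2 / 2 := by
      gcongr
      exact subgradGap_mul_le _ _ _ (Set.Ioc_subset_Icc_self hs)
    _ = s * (subgradGap (xs i) (dual A y xs i) t +
        s * (euclNorm (A *ᵥ Pi.single i t) ^ 2 / 2)) := by ring

theorem IsLasso.abs_dual_le_one (hxs : IsLasso A y xs) (i : Fin p) : |dual A y xs i| ≤ 1 :=
  (abs_le_one_and_mul_self_of_subgradGap_nonneg (hxs.subgradGap_nonneg i)).1

theorem IsLasso.dual_mul_self (hxs : IsLasso A y xs) (i : Fin p) :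
    dual A y xs i * xs i = |xs i| :=
  (abs_le_one_and_mul_self_of_subgradGap_nonneg (hxs.subgradGap_nonneg i)).2

theorem IsLasso.abs_dual_eq_one (hxs : IsLasso A y xs) {i : Fin p} (hi : xs i ≠ 0) :
    |dual A y xs i| = 1 :=
  mul_right_cancel₀ (abs_ne_zero.2 hi) <| by
    rw [← abs_mul, hxs.dual_mul_self, abs_abs, one_mul]

theorem IsLasso.bdryI_eq (hxs : IsLasso A y xs) : bdryI A y xs = supp xs ∪ bdryI0 A y xs := by
  ext i
  simp only [bdryI, supp, bdryI0, Finset.mem_union, Finset.mem_filter, Finset.mem_univ, true_and]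
  by_cases h : xs i = 0
  · simp [h]
  · simp [h, hxs.abs_dual_eq_one h]

end Optimality

section RescaledGap

@[to_additive]
theorem prod_coe_mul_prod_coe {ι M : Type*} [Fintype ι] [CommMonoid M]
    {s t : Finset ι} (h : IsCompl s t) (f : ι → M) :
    (∏ i : s, f i) * ∏ i : t, f i = ∏ i, f i := by
  classical
  rw [Finset.prod_coe_sort s f, Finset.prod_coe_sort t f, h.prod_mul_prod]

variable {A : Matrix (Fin n) (Fin p) ℝ} {y : Fin n → ℝ} {xs : Fin p → ℝ} {K J : Finset (Fin p)}

theorem cols_mulVec_add_cols_mulVec (A : Matrix (Fin n) (Fin p) ℝ) (hKJ : IsCompl K J)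
    (x : Fin p → ℝ) : cols A K *ᵥ K.restrict x + cols A J *ᵥ J.restrict x = A *ᵥ x := by
  ext k
  exact sum_coe_add_sum_coe hKJ fun i => A k i * x i

/-- The scale of the fluctuations of the `i`-th coordinate at inverse temperature `β`:
`β^(-1/2)` on the block `J`, and `β⁻¹` off it. -/
def blockScale (J : Finset (Fin p)) (β : ℝ) (i : Fin p) : ℝ := if i ∈ J then (√β)⁻¹ else β⁻¹

theorem blockScale_of_mem {i : Fin p} (hi : i ∈ J) (β : ℝ) : blockScale J β i = (√β)⁻¹ := if_pos hi

theorem blockScale_of_notMem {i : Fin p} (hi : i ∉ J) (β : ℝ) : blockScale J β i = β⁻¹ := if_neg hi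

theorem blockScale_pos {β : ℝ} (hβ : 0 < β) (i : Fin p) : 0 < blockScale J β i := by
  unfold blockScale
  split_ifs <;> positivity

/-- The excess `β (F(x) - F(xs))` of the objective at the point `x` whose fluctuation around `xs`,
measured in the units `blockScale J β`, is `z`. -/
def rescaledGap (A : Matrix (Fin n) (Fin p) ℝ) (y : Fin n → ℝ) (xs : Fin p → ℝ)
    (J : Finset (Fin p)) (β : ℝ) (z : Fin p → ℝ) : ℝ :=
  β * (objective A y (xs + blockScale J β * z) - objective A y xs)

theorem continuous_rescaledGap (β : ℝ) : Continuous (rescaledGap A y xs J β) := by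
  have : Continuous fun z => objective A y (xs + blockScale J β * z) :=
    (continuous_objective A y).comp (by fun_prop)
  unfold rescaledGap
  fun_prop

/-- The vector `√β A (blockScale J β * z)`, written through the columns of the two blocks so that
its limit as `β → +∞` can be read off. -/
def rescaledImage (A : Matrix (Fin n) (Fin p) ℝ) (K J : Finset (Fin p)) (β : ℝ) (z : Fin p → ℝ) :
    Fin n → ℝ :=
  (√β)⁻¹ • (cols A K *ᵥ K.restrict z) + cols A J *ᵥ J.restrict z

theorem mulVec_blockScale_mul (A : Matrix (Fin n) (Fin p) ℝ) (hKJ : IsCompl K J) {β : ℝ}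
    (hβ : 0 ≤ β) (z : Fin p → ℝ) :
    A *ᵥ (blockScale J β * z) = (√β)⁻¹ • rescaledImage A K J β z := by
  have hK : K.restrict (blockScale J β * z) = ((√β)⁻¹ * (√β)⁻¹) • K.restrict z := by
    ext i
    have hi : (i : Fin p) ∉ J := Finset.disjoint_left.1 hKJ.disjoint i.2
    simp [blockScale_of_notMem hi, ← mul_inv, Real.mul_self_sqrt hβ]
  have hJ : J.restrict (blockScale J β * z) = (√β)⁻¹ • J.restrict z := by
    ext i
    simp [blockScale_of_mem i.2]
  rw [← cols_mulVec_add_cols_mulVec A hKJ, hK, hJ, mulVec_smul, mulVec_smul, rescaledImage,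
    smul_add, smul_smul]

theorem rescaledGap_eq (hKJ : IsCompl K J) {β : ℝ} (hβ : 0 < β) (z : Fin p → ℝ) :
    rescaledGap A y xs J β z =
      ∑ i, β * subgradGap (xs i) (dual A y xs i) (blockScale J β i * z i) +
        euclNorm (rescaledImage A K J β z) ^ 2 / 2 := by
  rw [rescaledGap, objective_add, mulVec_blockScale_mul A hKJ hβ.le, euclNorm_smul, mul_pow,
    sq_abs, inv_pow, Real.sq_sqrt hβ.le, mul_add, Finset.mul_sum]
  congr 1
  field_simp

theorem mul_subgradGap_blockScale {β : ℝ} (hβ : 0 < β) {i : Fin p} (hi : i ∉ J) (ξ h : ℝ) :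
    β * subgradGap 0 ξ (blockScale J β i * h) = subgradGap 0 ξ h := by
  rw [subgradGap_zero_mul (blockScale_pos hβ i).le, blockScale_of_notMem hi,
    mul_inv_cancel_left₀ hβ.ne']

theorem mul_sum_abs_le_sum_subgradGap (hxs : IsLasso A y xs) (hKJ : IsCompl K J)
    (hK : ∀ i ∈ K, xs i = 0) {c : ℝ} (hc : ∀ i ∈ K, c ≤ 1 - |dual A y xs i|)
    {β : ℝ} (hβ : 0 < β) (z : Fin p → ℝ) :
    c * ∑ i : K, |z i| ≤
      ∑ i, β * subgradGap (xs i) (dual A y xs i) (blockScale J β i * z i) := by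
  rw [← sum_coe_add_sum_coe hKJ, Finset.mul_sum, ← add_zero (∑ i : K, _)]
  refine add_le_add (Finset.sum_le_sum fun i _ => ?_)
    (Finset.sum_nonneg fun i _ => mul_nonneg hβ.le (hxs.subgradGap_nonneg _ _))
  rw [hK i i.2, mul_subgradGap_blockScale hβ (Finset.disjoint_left.1 hKJ.disjoint i.2)]
  exact (mul_le_mul_of_nonneg_right (hc i i.2) (abs_nonneg _)).trans
    (one_sub_abs_mul_abs_le_subgradGap _ _)

theorem exists_mul_sum_abs_le_rescaledGap (hxs : IsLasso A y xs) (hKJ : IsCompl K J)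
    (hK : ∀ i ∈ K, xs i = 0 ∧ |dual A y xs i| ≠ 1) (hJ : IsUnit ((cols A J)ᵀ * cols A J)) :
    ∃ c C, 0 < c ∧ ∀ β ≥ 1, ∀ z, c * ∑ i, |z i| - C ≤ rescaledGap A y xs J β z := by
  obtain ⟨c, hc, hcK⟩ := Pi.exists_forall_pos_add_lt (x := fun i : K => |dual A y xs i|)
    (y := fun _ => 1) fun i => lt_of_le_of_ne (hxs.abs_dual_le_one i) (hK i i.2).2
  obtain ⟨c', C, hc', hC⟩ := exists_mul_sum_abs_le_add_euclNorm_sq (cols A K) hJ hc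
  refine ⟨c', C, hc', fun β hβ z => ?_⟩
  have hβ0 : 0 < β := one_pos.trans_le hβ
  have hτ : (√β)⁻¹ ∈ Set.Icc (0 : ℝ) 1 :=
    ⟨by positivity, inv_le_one_of_one_le₀ (Real.one_le_sqrt.2 hβ)⟩
  rw [rescaledGap_eq hKJ hβ0, ← sum_coe_add_sum_coe hKJ]
  refine (hC _ hτ (K.restrict z) (J.restrict z)).trans (add_le_add_left ?_ _)
  exact mul_sum_abs_le_sum_subgradGap hxs hKJ (fun i hi => (hK i hi).1)
    (fun i hi => by linarith [hcK ⟨i, hi⟩]) hβ0 z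

end RescaledGap

section Limit

theorem tendsto_mul_subgradGap_zero_atTop {ξ v : ℝ} (hv : 0 < subgradGap 0 ξ v) :
    Tendsto (fun β : ℝ => β * subgradGap 0 ξ ((√β)⁻¹ * v)) atTop atTop := by
  refine (Real.tendsto_sqrt_atTop.atTop_mul_const hv).congr' ?_
  filter_upwards [eventually_gt_atTop 0] with β hβ
  rw [subgradGap_zero_mul (by positivity), ← mul_assoc, ← div_eq_mul_inv, Real.div_sqrt]

theorem eventually_subgradGap_eq_zero {x ξ : ℝ} (hx : x ≠ 0) (hξ : ξ * x = |x|) (v : ℝ) :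
    ∀ᶠ β : ℝ in atTop, subgradGap x ξ ((√β)⁻¹ * v) = 0 := by
  have hlim : Tendsto (fun β : ℝ => x * (x + (√β)⁻¹ * v)) atTop (𝓝 (x * (x + 0 * v))) :=
    ((Real.tendsto_sqrt_atTop.inv_tendsto_atTop.mul_const v).const_add x).const_mul x
  have hpos : 0 < x * (x + 0 * v) := by simpa using mul_self_pos.2 hx
  filter_upwards [hlim.eventually_const_lt hpos] with β hβ using subgradGap_eq_zero hξ hβ

theorem tendsto_exp_neg_mul_subgradGap {κ x ξ : ℝ} (hκ : 0 < κ) (hξ : |ξ| = 1) (hx : ξ * x = |x|)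
    (v : ℝ) :
    Tendsto (fun β : ℝ => Real.exp (-(κ * (β * subgradGap x ξ ((√β)⁻¹ * v))))) atTop
      (𝓝 (if x = 0 → 0 ≤ ξ * v then 1 else 0)) := by
  by_cases h : x = 0 → 0 ≤ ξ * v
  · rw [if_pos h]
    refine tendsto_const_nhds.congr' ?_
    suffices ∀ᶠ β : ℝ in atTop, subgradGap x ξ ((√β)⁻¹ * v) = 0 by
      filter_upwards [this] with β hβ
      rw [hβ, mul_zero, mul_zero, neg_zero, Real.exp_zero]
    by_cases h0 : x = 0
    · subst h0
      refine Eventually.of_forall fun β => ?_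
      rw [subgradGap_zero_mul (by positivity), (subgradGap_zero_eq_zero_iff hξ).2 (h rfl), mul_zero]
    · exact eventually_subgradGap_eq_zero h0 hx v
  · rw [if_neg h]
    obtain ⟨rfl, hv⟩ := Classical.not_imp.1 h
    have hpos : 0 < subgradGap 0 ξ v := (subgradGap_zero_nonneg hξ.le v).lt_of_ne'
      fun h0 => hv ((subgradGap_zero_eq_zero_iff hξ).1 h0)
    exact Real.tendsto_exp_neg_atTop_nhds_zero.comp
      ((tendsto_mul_subgradGap_zero_atTop hpos).const_mul_atTop hκ)

variable {A : Matrix (Fin n) (Fin p) ℝ} {y : Fin n → ℝ} {xs : Fin p → ℝ} {K J : Finset (Fin p)}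
  {κ : ℝ}

theorem tendsto_rescaledImage (z : Fin p → ℝ) :
    Tendsto (fun β => rescaledImage A K J β z) atTop (𝓝 (cols A J *ᵥ J.restrict z)) := by
  simpa [rescaledImage] using (Real.tendsto_sqrt_atTop.inv_tendsto_atTop.smul_const
    (cols A K *ᵥ K.restrict z)).add_const (cols A J *ᵥ J.restrict z)

theorem exp_neg_mul_rescaledGap_eq (hKJ : IsCompl K J) (hK : ∀ i ∈ K, xs i = 0) {β : ℝ}
    (hβ : 0 < β) (z : Fin p → ℝ) :
    Real.exp (-(κ * rescaledGap A y xs J β z)) =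
      (∏ i : K, Real.exp (-(κ * subgradGap 0 (dual A y xs i) (z i)))) *
      ((∏ i : J, Real.exp (-(κ * (β * subgradGap (xs i) (dual A y xs i) ((√β)⁻¹ * z i))))) *
        Real.exp (-(κ * (euclNorm (rescaledImage A K J β z) ^ 2 / 2)))) := by
  have hfactorK (i : K) : Real.exp (-(κ * subgradGap 0 (dual A y xs i) (z i))) =
      Real.exp (-(κ * (β * subgradGap (xs i) (dual A y xs i) (blockScale J β i * z i)))) := by
    rw [hK i i.2, mul_subgradGap_blockScale hβ (Finset.disjoint_left.1 hKJ.disjoint i.2)]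
  have hfactorJ (i : J) :
      Real.exp (-(κ * (β * subgradGap (xs i) (dual A y xs i) ((√β)⁻¹ * z i)))) =
      Real.exp (-(κ * (β * subgradGap (xs i) (dual A y xs i) (blockScale J β i * z i)))) := by
    rw [blockScale_of_mem i.2]
  rw [rescaledGap_eq hKJ hβ, mul_add, neg_add, Real.exp_add, ← mul_assoc]
  congr 1
  rw [Finset.prod_congr rfl fun i _ => hfactorK i, Finset.prod_congr rfl fun i _ => hfactorJ i,
    prod_coe_mul_prod_coe hKJ fun i => Real.exp
      (-(κ * (β * subgradGap (xs i) (dual A y xs i) (blockScale J β i * z i)))),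
    ← Real.exp_sum, Finset.mul_sum, Finset.sum_neg_distrib]

theorem tendsto_exp_neg_mul_rescaledGap (hκ : 0 < κ) (hxs : IsLasso A y xs) (hKJ : IsCompl K J)
    (hK : ∀ i ∈ K, xs i = 0) (hJ : ∀ i ∈ J, |dual A y xs i| = 1) (z : Fin p → ℝ) :
    Tendsto (fun β => Real.exp (-(κ * rescaledGap A y xs J β z))) atTop
      (𝓝 ((∏ i : K, Real.exp (-(κ * subgradGap 0 (dual A y xs i) (z i)))) *
        ((∏ i : J, if xs i = 0 → 0 ≤ dual A y xs i * z i then 1 else 0) *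
          Real.exp (-(κ * (euclNorm (cols A J *ᵥ J.restrict z) ^ 2 / 2)))))) := by
  have hexp : Tendsto (fun β => Real.exp (-(κ * (euclNorm (rescaledImage A K J β z) ^ 2 / 2))))
      atTop (𝓝 (Real.exp (-(κ * (euclNorm (cols A J *ᵥ J.restrict z) ^ 2 / 2))))) := by
    have hcont : Continuous fun w : Fin n → ℝ => Real.exp (-(κ * (euclNorm w ^ 2 / 2))) := by
      have := continuous_euclNorm (m := Fin n)
      fun_prop
    exact (hcont.tendsto _).comp (tendsto_rescaledImage z)
  have hprod := tendsto_finsetProd Finset.univ fun (i : J) _ =>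
    tendsto_exp_neg_mul_subgradGap hκ (hJ i i.2) (hxs.dual_mul_self i) (z i)
  refine ((hprod.mul hexp).const_mul _).congr' ?_
  filter_upwards [eventually_gt_atTop 0] with β hβ
  exact (exp_neg_mul_rescaledGap_eq hKJ hK hβ z).symm

end Limit

section LimitDensities

/-- The block `I₀ ∖ ∂I₀` of the coordinates with fluctuations of order `β⁻¹`. -/
abbrev inactive (A : Matrix (Fin n) (Fin p) ℝ) (y : Fin n → ℝ) (xs : Fin p → ℝ) :
    Finset (Fin p) :=
  I0 xs \ bdryI0 A y xs

/-- The block `S ∪ ∂I₀` of the coordinates with fluctuations of order `β^(-1/2)`. -/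
abbrev active (A : Matrix (Fin n) (Fin p) ℝ) (y : Fin n → ℝ) (xs : Fin p → ℝ) : Finset (Fin p) :=
  supp xs ∪ bdryI0 A y xs

variable {A : Matrix (Fin n) (Fin p) ℝ} {y : Fin n → ℝ} {xs : Fin p → ℝ} {κ : ℝ}

theorem mem_bdryI0 {i : Fin p} : i ∈ bdryI0 A y xs ↔ xs i = 0 ∧ |dual A y xs i| = 1 := by
  simp [bdryI0]

theorem mem_inactive {i : Fin p} : i ∈ inactive A y xs ↔ xs i = 0 ∧ |dual A y xs i| ≠ 1 := by
  rw [inactive, Finset.mem_sdiff, mem_bdryI0]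
  simp +contextual [I0]

theorem mem_active {i : Fin p} : i ∈ active A y xs ↔ (xs i = 0 → |dual A y xs i| = 1) := by
  rw [active, Finset.mem_union, mem_bdryI0]
  simp only [supp, Finset.mem_filter, Finset.mem_univ, true_and]
  tauto

theorem isCompl_inactive_active : IsCompl (inactive A y xs) (active A y xs) := by
  have : inactive A y xs = (active A y xs)ᶜ := by
    ext i
    rw [Finset.mem_compl, mem_inactive, mem_active, Classical.not_imp]
  exact this ▸ isCompl_compl.symm

theorem abs_mul_sign (x : ℝ) : |x| * Real.sign x = x := by
  rcases lt_trichotomy x 0 with h | rfl | h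
  · rw [Real.sign_of_neg h, abs_of_neg h, neg_mul_neg, mul_one]
  · rw [abs_zero, zero_mul]
  · rw [Real.sign_of_pos h, abs_of_pos h, mul_one]

theorem laplaceDensity_eq_prod (u : inactive A y xs → ℝ) :
    laplaceDensity A y xs κ u =
      ∏ i : inactive A y xs, Real.exp (-(κ * subgradGap 0 (dual A y xs i) (u i))) := by
  refine Finset.prod_congr rfl fun i _ => ?_
  rw [mul_one_sub, ← mul_assoc, abs_mul_sign, subgradGap_zero_left, mul_comm (u i)]

theorem gaussDensity_eq_prod_mul (v : active A y xs → ℝ) :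
    gaussDensity A y xs κ v =
      (∏ i : active A y xs, if xs i = 0 → 0 ≤ dual A y xs i * v i then 1 else 0) *
        Real.exp (-(κ * (euclNorm (cols A (active A y xs) *ᵥ v) ^ 2 / 2))) := by
  have hmem (i : active A y xs) : (i : Fin p) ∈ bdryI0 A y xs ↔ xs i = 0 :=
    mem_bdryI0.trans (and_iff_left_of_imp (mem_active.1 i.2))
  simp only [gaussDensity, Set.indicator, Set.mem_ofPred_eq, hmem, Fintype.prod_boole]
  rw [ite_mul, one_mul, zero_mul]

theorem measurable_laplaceDensity : Measurable (laplaceDensity A y xs κ) := by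
  have h (i : Fin p) := continuous_subgradGap 0 (dual A y xs i)
  rw [funext laplaceDensity_eq_prod]
  exact Continuous.measurable (by fun_prop)

theorem laplaceDensity_pos (u : inactive A y xs → ℝ) : 0 < laplaceDensity A y xs κ u :=
  Finset.prod_pos fun _ _ => Real.exp_pos _

theorem measurable_gaussDensity : Measurable (gaussDensity A y xs κ) := by
  refine Measurable.indicator ?_ ?_
  · have h := continuous_euclNorm (m := Fin n)
    exact Continuous.measurable (by fun_prop)
  · simp only [Set.ofPred_forall]
    refine MeasurableSet.iInter fun i => MeasurableSet.iInter fun _ => ?_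
    exact measurableSet_le measurable_const (by fun_prop)

theorem gaussDensity_nonneg (v : active A y xs → ℝ) : 0 ≤ gaussDensity A y xs κ v :=
  Set.indicator_nonneg (fun _ _ => (Real.exp_pos _).le) v

theorem gaussDensity_pos {v : active A y xs → ℝ}
    (hv : ∀ i : active A y xs, (i : Fin p) ∈ bdryI0 A y xs → 0 ≤ dual A y xs i * v i) :
    0 < gaussDensity A y xs κ v := by
  rw [gaussDensity, Set.indicator_of_mem (by exact hv)]
  exact Real.exp_pos _

theorem tendsto_exp_neg_mul_rescaledGap_active (hκ : 0 < κ) (hxs : IsLasso A y xs)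
    (z : Fin p → ℝ) :
    Tendsto (fun β => Real.exp (-(κ * rescaledGap A y xs (active A y xs) β z))) atTop
      (𝓝 (laplaceDensity A y xs κ ((inactive A y xs).restrict z) *
        gaussDensity A y xs κ ((active A y xs).restrict z))) := by
  rw [laplaceDensity_eq_prod, gaussDensity_eq_prod_mul]
  refine tendsto_exp_neg_mul_rescaledGap hκ hxs isCompl_inactive_active
    (fun i hi => (mem_inactive.1 hi).1) (fun i hi => ?_) z
  by_cases h0 : xs i = 0
  exacts [mem_active.1 hi h0, hxs.abs_dual_eq_one h0]

end LimitDensities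

section ExponentialIntegrability

theorem integrable_exp_neg_mul_abs {a : ℝ} (ha : 0 < a) :
    Integrable fun x : ℝ => Real.exp (-(a * |x|)) := by
  rw [← integrableOn_univ, ← Set.Iic_union_Ioi (a := (0 : ℝ)), integrableOn_union]
  constructor
  · refine (integrableOn_exp_mul_Iic ha 0).congr_fun (fun x hx => ?_) measurableSet_Iic
    simp only [abs_of_nonpos (Set.mem_Iic.1 hx), mul_neg, neg_neg]
  · refine (integrableOn_exp_mul_Ioi (neg_lt_zero.2 ha) 0).congr_fun (fun x hx => ?_)
      measurableSet_Ioi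
    simp only [abs_of_pos (Set.mem_Ioi.1 hx), neg_mul]

theorem integrable_exp_neg_mul_sum_abs {ι : Type*} [Fintype ι] {a : ℝ} (ha : 0 < a) :
    Integrable fun x : ι → ℝ => Real.exp (-(a * ∑ i, |x i|)) := by
  have := Integrable.fintype_prod (ι := ι) (μ := fun _ => (volume : Measure ℝ))
    (f := fun _ x => Real.exp (-(a * |x|))) fun _ => integrable_exp_neg_mul_abs ha
  refine this.congr (Eventually.of_forall fun x => ?_)
  simp only [← Real.exp_sum, Finset.mul_sum, Finset.sum_neg_distrib]

end ExponentialIntegrability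

section LebesgueDensity

variable {α γ ι : Type*} [MeasurableSpace α] [MeasurableSpace γ] [Fintype ι]

theorem map_withDensity_comp (μ : Measure α) {e : α → γ} (he : Measurable e) {f : γ → ENNReal}
    (hf : Measurable f) : (μ.withDensity (f ∘ e)).map e = (μ.map e).withDensity f := by
  ext B hB
  rw [Measure.map_apply he hB, withDensity_apply _ (he hB), withDensity_apply _ hB,
    setLIntegral_map hB hf he]
  rfl

/-- The measure on `ℝ^ι` with Lebesgue density `h`, where negative values of `h` count as `0`. -/
abbrev lebesgueDensity (h : (ι → ℝ) → ℝ) : Measure (ι → ℝ) :=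
  volume.withDensity fun x => ENNReal.ofReal (h x)

theorem measureOfPropDensity_eq_normalized (h : (ι → ℝ) → ℝ) :
    measureOfPropDensity h = normalized (lebesgueDensity h) := by
  rw [measureOfPropDensity, lebesgueDensity, normalized, withDensity_apply _ MeasurableSet.univ,
    Measure.restrict_univ]

theorem neZero_lebesgueDensity {h : (ι → ℝ) → ℝ} (hh : Measurable h) {s : Set (ι → ℝ)}
    (hs : IsOpen s) (hne : s.Nonempty) (hpos : ∀ x ∈ s, 0 < h x) : NeZero (lebesgueDensity h) := by
  refine ⟨fun h0 => (hs.measure_pos volume hne).ne' ?_⟩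
  have hae := (withDensity_eq_zero_iff hh.ennreal_ofReal.aemeasurable).1 h0
  refine measure_mono_null (fun x hx => ?_) (ae_iff.1 hae)
  exact (ENNReal.ofReal_pos.2 (hpos x hx)).ne'

theorem measureOfPropDensity_const_mul {c : ℝ} (hc : 0 < c) (h : (ι → ℝ) → ℝ) :
    measureOfPropDensity (fun x => c * h x) = measureOfPropDensity h := by
  have : lebesgueDensity (fun x => c * h x) = ENNReal.ofReal c • lebesgueDensity h := by
    rw [lebesgueDensity, lebesgueDensity, ← withDensity_smul' _ _ ENNReal.ofReal_ne_top]
    congr with x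
    exact ENNReal.ofReal_mul hc.le
  rw [measureOfPropDensity_eq_normalized, this,
    normalized_smul _ (ENNReal.ofReal_pos.2 hc).ne' ENNReal.ofReal_ne_top,
    measureOfPropDensity_eq_normalized]

theorem map_mul_volume_eq_smul {a : ι → ℝ} (ha : ∀ i, a i ≠ 0) :
    (volume : Measure (ι → ℝ)).map (fun x => a * x) = ENNReal.ofReal |(∏ i, a i)⁻¹| • volume := by
  classical
  have hdet : (Matrix.diagonal a).det ≠ 0 := by
    rw [Matrix.det_diagonal]
    exact Finset.prod_ne_zero_iff.2 fun i _ => ha i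
  have hmul : ⇑(Matrix.toLin' (Matrix.diagonal a)) = fun x => a * x := by
    ext x i
    rw [Matrix.toLin'_apply, Matrix.mulVec_diagonal, Pi.mul_apply]
  rw [← hmul, Real.map_matrix_volume_pi_eq_smul_volume_pi hdet, Matrix.det_diagonal]

theorem map_mul_sub_volume_eq_smul {a : ι → ℝ} (ha : ∀ i, a i ≠ 0) (x₀ : ι → ℝ) :
    (volume : Measure (ι → ℝ)).map (fun x => a * (x - x₀)) =
      ENNReal.ofReal |(∏ i, a i)⁻¹| • volume := by
  calc (volume : Measure (ι → ℝ)).map (fun x => a * (x - x₀))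
      = (volume.map fun x => x - x₀).map (fun x => a * x) :=
        (Measure.map_map (by fun_prop) (by fun_prop)).symm
    _ = _ := by rw [map_sub_right_eq_self, map_mul_volume_eq_smul ha]

theorem map_measureOfPropDensity {h : (ι → ℝ) → ℝ} (hh : Measurable h) {s : ι → ℝ}
    (hs : ∀ i, s i ≠ 0) (x₀ : ι → ℝ) :
    (measureOfPropDensity h).map (fun x => s⁻¹ * (x - x₀)) =
      measureOfPropDensity fun z => h (x₀ + s * z) := by
  have he : Measurable fun x : ι → ℝ => s⁻¹ * (x - x₀) := by fun_prop
  have hcomp : (fun x => ENNReal.ofReal (h x)) =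
      (fun z => ENNReal.ofReal (h (x₀ + s * z))) ∘ fun x => s⁻¹ * (x - x₀) := by
    ext x
    have : s * (s⁻¹ * (x - x₀)) = x - x₀ := by
      ext i
      exact mul_inv_cancel_left₀ (hs i) _
    rw [Function.comp_apply, this, add_sub_cancel]
  rw [measureOfPropDensity_eq_normalized, measureOfPropDensity_eq_normalized, map_normalized _ he,
    lebesgueDensity, hcomp, map_withDensity_comp _ he (by fun_prop)]
  have ha (i : ι) : s⁻¹ i ≠ 0 := inv_ne_zero (hs i)
  have hdet : 0 < |(∏ i, s⁻¹ i)⁻¹| :=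
    abs_pos.2 (inv_ne_zero (Finset.prod_ne_zero_iff.2 fun i _ => ha i))
  rw [map_mul_sub_volume_eq_smul ha, withDensity_smul_measure,
    normalized_smul _ (ENNReal.ofReal_pos.2 hdet).ne' ENNReal.ofReal_ne_top]

end LebesgueDensity

section Blocks

variable {ι : Type*} [Fintype ι] {K J : Finset ι}

theorem measurePreserving_restrict_restrict (hKJ : IsCompl K J) :
    MeasurePreserving fun z : ι → ℝ => (K.restrict z, J.restrict z) := by
  have hbij : Function.Bijective (Sum.elim (↑) (↑) : K ⊕ J → ι) := by
    refine ⟨Subtype.val_injective.sumElim Subtype.val_injective fun i j hij => ?_, fun i => ?_⟩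
    · exact Finset.disjoint_left.1 hKJ.disjoint i.2 (hij ▸ j.2)
    · by_cases hi : i ∈ K
      exacts [⟨Sum.inl ⟨i, hi⟩, rfl⟩,
        ⟨Sum.inr ⟨i, Finset.codisjoint_left.1 hKJ.codisjoint hi⟩, rfl⟩]
  exact (volume_measurePreserving_sumPiEquivProdPi fun _ : K ⊕ J => ℝ).comp
    (volume_measurePreserving_piCongrLeft (fun _ : ι => ℝ) (Equiv.ofBijective _ hbij)).symm

theorem map_lebesgueDensity_mul (hKJ : IsCompl K J) {f : (K → ℝ) → ℝ} {g : (J → ℝ) → ℝ}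
    (hf : Measurable f) (hg : Measurable g) (hf0 : 0 ≤ f) :
    (lebesgueDensity fun z : ι → ℝ => f (K.restrict z) * g (J.restrict z)).map
        (fun z => (K.restrict z, J.restrict z)) =
      (lebesgueDensity f).prod (lebesgueDensity g) := by
  have hpres := measurePreserving_restrict_restrict hKJ
  have hcomp : (fun z : ι → ℝ => ENNReal.ofReal (f (K.restrict z) * g (J.restrict z))) =
      (fun w : (K → ℝ) × (J → ℝ) => ENNReal.ofReal (f w.1) * ENNReal.ofReal (g w.2)) ∘
        fun z => (K.restrict z, J.restrict z) :=
    funext fun z => ENNReal.ofReal_mul (hf0 _)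
  rw [lebesgueDensity, hcomp, map_withDensity_comp _ hpres.measurable (by fun_prop), hpres.map_eq]
  exact (prod_withDensity hf.ennreal_ofReal hg.ennreal_ofReal).symm

end Blocks

section JointLaw

variable {A : Matrix (Fin n) (Fin p) ℝ} {y : Fin n → ℝ} {xs : Fin p → ℝ} {κ : ℝ}

theorem map_mul_sub_posterior (A : Matrix (Fin n) (Fin p) ℝ) (y : Fin n → ℝ) (κ : ℝ)
    (xs : Fin p → ℝ) (J : Finset (Fin p)) {β : ℝ} (hβ : 0 < β) :
    (posterior A y κ β).map (fun x => (blockScale J β)⁻¹ * (x - xs)) =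
      measureOfPropDensity fun z => Real.exp (-(κ * rescaledGap A y xs J β z)) := by
  have hmeas : Measurable fun x => Real.exp (-(κ * β * objective A y x)) := by
    have := continuous_objective A y
    exact Continuous.measurable (by fun_prop)
  rw [posterior, map_measureOfPropDensity hmeas (fun i => (blockScale_pos hβ i).ne'),
    ← measureOfPropDensity_const_mul (Real.exp_pos (κ * β * objective A y xs))]
  congr with z
  rw [← Real.exp_add, rescaledGap]
  congr 1
  ring

theorem map_blocks_posterior (A : Matrix (Fin n) (Fin p) ℝ) (y : Fin n → ℝ) (κ : ℝ)
    {K J : Finset (Fin p)} (hKJ : Disjoint K J) (hK : ∀ i ∈ K, xs i = 0) {β : ℝ} (hβ : 0 < β) :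
    (posterior A y κ β).map
        (fun x => ((fun i : K => β * x i), fun i : J => √β * (x i - xs i))) =
      (measureOfPropDensity fun z => Real.exp (-(κ * rescaledGap A y xs J β z))).map
        fun z => (K.restrict z, J.restrict z) := by
  rw [← map_mul_sub_posterior A y κ xs J hβ, Measure.map_map (by fun_prop) (by fun_prop)]
  congr with x i
  · have hi : (i : Fin p) ∉ J := Finset.disjoint_left.1 hKJ i.2
    simp [blockScale_of_notMem hi, hK i i.2]
  · simp [blockScale_of_mem i.2]

/-- The Lebesgue density of the limit of the rescaled posterior, up to normalization. -/
def limitDensity (A : Matrix (Fin n) (Fin p) ℝ) (y : Fin n → ℝ) (xs : Fin p → ℝ) (κ : ℝ)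
    (z : Fin p → ℝ) : ℝ :=
  laplaceDensity A y xs κ ((inactive A y xs).restrict z) *
    gaussDensity A y xs κ ((active A y xs).restrict z)

theorem exists_integrable_bound (hκ : 0 < κ) (hxs : IsLasso A y xs)
    (hA : IsUnit ((cols A (active A y xs))ᵀ * cols A (active A y xs))) :
    ∃ G : (Fin p → ℝ) → ℝ, Integrable G ∧
      ∀ β ≥ 1, ∀ z, Real.exp (-(κ * rescaledGap A y xs (active A y xs) β z)) ≤ G z := by
  obtain ⟨c, C, hc, h⟩ := exists_mul_sum_abs_le_rescaledGap hxs isCompl_inactive_active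
    (fun i => mem_inactive.1) hA
  refine ⟨_, (integrable_exp_neg_mul_sum_abs (mul_pos hκ hc)).const_mul (Real.exp (κ * C)),
    fun β hβ z => ?_⟩
  rw [← Real.exp_add, Real.exp_le_exp]
  linarith [mul_le_mul_of_nonneg_left (h β hβ z) hκ.le]

theorem isFiniteMeasure_limitDensity (hκ : 0 < κ) (hxs : IsLasso A y xs)
    (hA : IsUnit ((cols A (active A y xs))ᵀ * cols A (active A y xs))) :
    IsFiniteMeasure (lebesgueDensity (limitDensity A y xs κ)) := by
  obtain ⟨G, hG, hle⟩ := exists_integrable_bound hκ hxs hA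
  refine isFiniteMeasure_withDensity_ofReal (hG.mono' ?_ (ae_of_all _ fun z => ?_)).2
  · exact ((measurable_laplaceDensity.comp (by fun_prop)).mul
      (measurable_gaussDensity.comp (by fun_prop))).aestronglyMeasurable
  · rw [limitDensity,
      Real.norm_of_nonneg (mul_nonneg (laplaceDensity_pos _).le (gaussDensity_nonneg _))]
    exact le_of_tendsto (tendsto_exp_neg_mul_rescaledGap_active hκ hxs z)
      ((eventually_ge_atTop 1).mono fun β hβ => hle β hβ z)

theorem tvClose_rescaledGap (hκ : 0 < κ) (hxs : IsLasso A y xs)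
    (hA : IsUnit ((cols A (active A y xs))ᵀ * cols A (active A y xs))) :
    TVClose
      (fun β => lebesgueDensity fun z =>
        Real.exp (-(κ * rescaledGap A y xs (active A y xs) β z)))
      (fun _ => lebesgueDensity (limitDensity A y xs κ)) := by
  obtain ⟨G, hG, hle⟩ := exists_integrable_bound hκ hxs hA
  refine tvClose_withDensity_of_dominated (fun β => ?_) (fun β z => (Real.exp_pos _).le) hG
    ((eventually_ge_atTop 1).mono hle) (tendsto_exp_neg_mul_rescaledGap_active hκ hxs)
  have := continuous_rescaledGap (A := A) (y := y) (xs := xs) (J := active A y xs) β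
  exact Continuous.measurable (by fun_prop)

theorem map_lebesgueDensity_limitDensity :
    (lebesgueDensity (limitDensity A y xs κ)).map
        (fun z => ((inactive A y xs).restrict z, (active A y xs).restrict z)) =
      (lebesgueDensity (laplaceDensity A y xs κ)).prod
        (lebesgueDensity (gaussDensity A y xs κ)) :=
  map_lebesgueDensity_mul isCompl_inactive_active measurable_laplaceDensity
    measurable_gaussDensity fun u => (laplaceDensity_pos u).le

instance neZero_laplaceDensity : NeZero (lebesgueDensity (laplaceDensity A y xs κ)) :=
  neZero_lebesgueDensity measurable_laplaceDensity isOpen_univ Set.univ_nonempty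
    fun u _ => laplaceDensity_pos u

instance neZero_gaussDensity : NeZero (lebesgueDensity (gaussDensity A y xs κ)) := by
  refine neZero_lebesgueDensity measurable_gaussDensity
    (s := {v | ∀ i : active A y xs, (i : Fin p) ∈ bdryI0 A y xs → 0 < dual A y xs i * v i})
    ?_ ⟨fun i => dual A y xs i, fun i hi => ?_⟩
    fun v hv => gaussDensity_pos fun i hi => (hv i hi).le
  · simp only [Set.ofPred_forall]
    exact isOpen_iInter_of_finite fun i => isOpen_iInter_of_finite fun _ =>
      isOpen_lt continuous_const (by fun_prop)
  · exact mul_self_pos.2 (abs_pos.1 ((mem_bdryI0.1 hi).2 ▸ one_pos))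

instance neZero_limitDensity : NeZero (lebesgueDensity (limitDensity A y xs κ)) := by
  refine ⟨fun h0 => ?_⟩
  have hmap := map_lebesgueDensity_limitDensity (A := A) (y := y) (xs := xs) (κ := κ)
  rw [h0, Measure.map_zero] at hmap
  exact NeZero.ne _ hmap.symm

theorem isFiniteMeasure_laplaceDensity_and_gaussDensity (hκ : 0 < κ) (hxs : IsLasso A y xs)
    (hA : IsUnit ((cols A (active A y xs))ᵀ * cols A (active A y xs))) :
    IsFiniteMeasure (lebesgueDensity (laplaceDensity A y xs κ)) ∧
      IsFiniteMeasure (lebesgueDensity (gaussDensity A y xs κ)) := by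
  have := isFiniteMeasure_limitDensity hκ hxs hA
  exact isFiniteMeasure_and_of_prod (map_lebesgueDensity_limitDensity ▸ inferInstance)

theorem isProbabilityMeasure_laplaceDensity_and_gaussDensity (hκ : 0 < κ) (hxs : IsLasso A y xs)
    (hA : IsUnit ((cols A (active A y xs))ᵀ * cols A (active A y xs))) :
    IsProbabilityMeasure (measureOfPropDensity (laplaceDensity A y xs κ)) ∧
      IsProbabilityMeasure (measureOfPropDensity (gaussDensity A y xs κ)) := by
  obtain ⟨_, _⟩ := isFiniteMeasure_laplaceDensity_and_gaussDensity hκ hxs hA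
  rw [measureOfPropDensity_eq_normalized, measureOfPropDensity_eq_normalized]
  exact ⟨inferInstance, inferInstance⟩

theorem tvClose_map_blocks_posterior (hκ : 0 < κ) (hxs : IsLasso A y xs)
    (hA : IsUnit ((cols A (active A y xs))ᵀ * cols A (active A y xs))) :
    TVClose
      (fun β => (posterior A y κ β).map fun x =>
        ((fun i : inactive A y xs => β * x i), fun i : active A y xs => √β * (x i - xs i)))
      (fun _ => (measureOfPropDensity (laplaceDensity A y xs κ)).prod
        (measureOfPropDensity (gaussDensity A y xs κ))) := by
  have := isFiniteMeasure_limitDensity hκ hxs hA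
  obtain ⟨_, _⟩ := isFiniteMeasure_laplaceDensity_and_gaussDensity hκ hxs hA
  have hmeas : Measurable fun z : Fin p → ℝ =>
      ((inactive A y xs).restrict z, (active A y xs).restrict z) := by fun_prop
  have map_limit : (normalized (lebesgueDensity (limitDensity A y xs κ))).map
        (fun z => ((inactive A y xs).restrict z, (active A y xs).restrict z)) =
      (measureOfPropDensity (laplaceDensity A y xs κ)).prod
        (measureOfPropDensity (gaussDensity A y xs κ)) := by
    rw [map_normalized _ hmeas, map_lebesgueDensity_limitDensity, normalized_prod,
      measureOfPropDensity_eq_normalized, measureOfPropDensity_eq_normalized]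
  rw [← map_limit]
  refine ((tvClose_rescaledGap hκ hxs hA).normalized.map hmeas).congr ?_
  filter_upwards [eventually_gt_atTop 0] with β hβ
  rw [map_blocks_posterior A y κ isCompl_inactive_active.disjoint
    (fun i hi => (mem_inactive.1 hi).1) hβ, measureOfPropDensity_eq_normalized]

end JointLaw

end BayesLasso

end

theorem mainTheorem4 {n p : ℕ} (A : Matrix (Fin n) (Fin p) ℝ) (y : Fin n → ℝ)
    (κ : ℝ) (hκ : 0 < κ)
    (xs : Fin p → ℝ) (hxs : BayesLasso.IsLasso A y xs)
    (hinv : IsUnit ((BayesLasso.cols A (BayesLasso.bdryI A y xs))ᵀ *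
      BayesLasso.cols A (BayesLasso.bdryI A y xs)))
    {Ω : ℝ → Type*} [∀ β, MeasurableSpace (Ω β)] (P : ∀ β, Measure (Ω β))
    [∀ β, IsProbabilityMeasure (P β)] (X : ∀ β, Ω β → Fin p → ℝ)
    (hX : ∀ β, 0 < β → HasLaw (X β) (BayesLasso.posterior A y κ β) (P β)) :
    BayesLasso.AsympIndep P
      (fun β ω (i : ↥(BayesLasso.I0 xs \ BayesLasso.bdryI0 A y xs)) => β * X β ω i)
      (fun β ω (i : ↥(BayesLasso.supp xs ∪ BayesLasso.bdryI0 A y xs)) =>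
        √β * (X β ω i - xs i)) ∧
    BayesLasso.HasAsympDensity P
      (fun β ω (i : ↥(BayesLasso.I0 xs \ BayesLasso.bdryI0 A y xs)) => β * X β ω i)
      (BayesLasso.laplaceDensity A y xs κ) ∧
    BayesLasso.HasAsympDensity P
      (fun β ω (i : ↥(BayesLasso.supp xs ∪ BayesLasso.bdryI0 A y xs)) =>
        √β * (X β ω i - xs i))
      (BayesLasso.gaussDensity A y xs κ) := by
  rw [hxs.bdryI_eq] at hinv
  obtain ⟨_, _⟩ :=
    BayesLasso.isProbabilityMeasure_laplaceDensity_and_gaussDensity hκ hxs hinv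
  have hjoint := BayesLasso.TVClose.of_hasLaw ((eventually_gt_atTop 0).mono hX)
    (fun β => by fun_prop) (BayesLasso.tvClose_map_blocks_posterior hκ hxs hinv)
  obtain ⟨hindep, hU, hV⟩ := BayesLasso.asympIndep_of_tvClose_prod hjoint
  exact ⟨hindep, ⟨inferInstance, hU⟩, ⟨inferInstance, hV⟩⟩
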